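/- Let $m\ge 0$, $N=2^m$, and let $\mathcal M$ be the set of squarefree monomials $x_1^{a_1}\cdots x_m^{a_m}$ over $\mathbb F_2$. For $a\in\mathbb F_2^m$ put $D(a)=1+\sum_{t=1}^m 2^{t-1}(a_t\oplus 1)\in\{1,\dots,N\}$; the index of $x_1^{a_1}\cdots x_m^{a_m}$ is $D(a)$, and the word $\mathrm{ev}(p)\in\mathbb F_2^N$ of a polynomial $p=\sum_{f\in\mathcal M}u_f f$ has the entry $p(a)$ at position $D(a)$. For $\mathcal I\subseteq\mathcal M$ let $C(\mathcal I)=\mathrm{span}\{\mathrm{ev}(f):f\in\mathcal I\}$; it is of $r$-th order if the maximum degree in $\mathcal I$ is $r$, and $\mathcal I_r$ is the set of degree-$r$ monomials in $\mathcal I$. Write $x_{i_1}\cdots x_{i_t}\preccurlyeq x_{j_1}\cdots x_{j_s}$ (indices increasing) if $t\le s$ and $i_{t-l}\le j_{s-l}$ for $0\le l<t$; $\mathcal I$ is decreasing if it is closed downwards under $\preccurlyeq$. Let $X_i=\{1,\dots,i\}$ and $Y_i=\{N-i+1,\dots,N\}$ for $0\le i\le N$. The Wang--Liu shortened code is $C_S(\mathcal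 I,Y_i)=\{c_{[N]\setminus Y_i}: c\in C(\mathcal I),\ c_{Y_i}=0\}$; it is called decreasing if the union of $\mathcal I$ and the set of monomials with index in $Y_i$ is decreasing. For a decreasing $\mathcal J\subseteq \mathcal M$ and $f\in\mathcal J$ let $T(f)=T_{\mathcal J}(f)$ be the set of polynomials $p$ with all monomials in $\mathcal J$ whose nonzero coefficient of smallest index is that of $f$ and with $\mathrm{wt}(\mathrm{ev}(p))=\mathrm{wt}(\mathrm{ev}(f))$. Let $T_S(f,Y_i)=\{\mathrm{ev}(p)_{[N]\setminus Y_i}:p\in T(f),\ \mathrm{ev}(p)_{Y_i}=0\}$, and let $P_f(w,i)$ be the number of words of weight $w$ in $\{\mathrm{ev}(p)_{[N]\setminus X_i}: p\in T(f)\}$. (1) If $\mathcal J$ is decreasing and $f\in\mathcal J$ has degree $r$, then $|T_S(f,Y_i)|=P_f(2^{m-r},i)$, and this is also the number of words of weight $2^{m-r}$ in $T_S(f,Y_i)$. (2) Let $C_S(\mathcal I,Y_i)$ be a shortened decreasing code of $r$-th order (the maximum degree in $\mathcal I$ is $r$) and let $d=2^{m-r}$. Then the number $A_d$ of words of weight $d$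 in $C_S(\mathcal I,Y_i)$ is $$A_d(C_S(\mathcal I,Y_i))=\sum_{f\in\mathcal I_r}P_f(d,i),$$ where the sets $T(f)$ are formed in any decreasing $\mathcal J\supseteq\mathcal I_r$ of $r$-th order. -/

import Mathlib

namespace PolarShortening

/-- The position map: `D m a` is the position of the point (or exponent vector) `a`, with positions
numbered from `0`, so that position `k` here is the `(k + 1)`-st coordinate of a length-`2 ^ m` word
(see `D_val`). The variables `x_1, …, x_m` are indexed by `Fin m`. -/
def D (m : ℕ) : (Fin m → ZMod 2) ≃ Fin (2 ^ m) :=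
  (Equiv.addRight (1 : Fin m → ZMod 2)).trans finFunctionFinEquiv

theorem D_val (m : ℕ) (a : Fin m → ZMod 2) :
    (D m a : ℕ) = ∑ t : Fin m, 2 ^ (t : ℕ) * (a t + 1).val := by
  refine (finFunctionFinEquiv_apply (m := 2) (n := m) (fun t => (a t + 1 : ZMod 2))).trans ?_
  refine Finset.sum_congr rfl fun t _ => ?_
  rw [Nat.mul_comm]
  rfl

/-- A monomial `∏_{t ∈ f} x_t` is given by its set of variables; its degree is `f.card`. -/
abbrev Mon (m : ℕ) : Type := Finset (Fin m)

/-- A polynomial `∑_f u_f f` with coefficients in `𝔽₂`, given by its coefficients. -/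
abbrev Poly (m : ℕ) : Type := Mon m → ZMod 2

/-- Words of length `2 ^ m`. -/
abbrev Word (m : ℕ) : Type := Fin (2 ^ m) → ZMod 2

/-- The value of the monomial `f` at the point `a`. -/
def Mon.eval {m : ℕ} (f : Mon m) (a : Fin m → ZMod 2) : ZMod 2 := ∏ t ∈ f, a t

/-- The value of the polynomial `p` at the point `a`. -/
def Poly.eval {m : ℕ} (p : Poly m) (a : Fin m → ZMod 2) : ZMod 2 := ∑ f, p f * Mon.eval f a

/-- The evaluation word of a monomial: its value at `a` stands at position `D m a`. -/
def Mon.ev {m : ℕ} (f : Mon m) : Word m := fun k => Mon.eval f ((D m).symm k)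

/-- The evaluation word of a polynomial: its value at `a` stands at position `D m a`. -/
def Poly.ev {m : ℕ} (p : Poly m) : Word m := fun k => Poly.eval p ((D m).symm k)

/-- The index of a monomial `x_1 ^ a_1 ⋯ x_m ^ a_m` is the position `D m a` of its exponent
vector. -/
def Mon.index {m : ℕ} (f : Mon m) : Fin (2 ^ m) := D m (fun t => if t ∈ f then 1 else 0)

/-- The monomial code with information set `I`. -/
def code {m : ℕ} (I : Finset (Mon m)) : Submodule (ZMod 2) (Word m) :=
  Submodule.span (ZMod 2) (Mon.ev '' (I : Set (Mon m)))

/-- `C(I)` is of `r`-th order: the maximum degree of the monomials in `I` is `r`. -/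
def HasOrder {m : ℕ} (I : Finset (Mon m)) (r : ℕ) : Prop :=
  (∃ f ∈ I, f.card = r) ∧ ∀ f ∈ I, f.card ≤ r

/-- The degree-`r` monomials of `I`. -/
def degPart {m : ℕ} (I : Finset (Mon m)) (r : ℕ) : Finset (Mon m) := I.filter fun f => f.card = r

/-- The order on monomials of equal degree: compare the increasingly sorted indices one by one. -/
def Mon.SameDegLE {m : ℕ} (f g : Mon m) : Prop :=
  ∃ h : g.card = f.card, ∀ l : Fin f.card, f.orderEmbOfFin rfl l ≤ g.orderEmbOfFin h l

/-- The order on all monomials: `f ≼ g` if `f ≼ g'` for a factor `g'` of `g` with the degree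
of `f`. -/
def Mon.LE {m : ℕ} (f g : Mon m) : Prop := ∃ g' : Mon m, g' ⊆ g ∧ Mon.SameDegLE f g'

/-- A set of monomials is decreasing if it is closed downwards. -/
def Decreasing {m : ℕ} (I : Finset (Mon m)) : Prop := ∀ f g : Mon m, Mon.LE f g → g ∈ I → f ∈ I

/-- The restriction of a word to the positions outside `X`. -/
def removePos {m : ℕ} (X : Finset (Fin (2 ^ m))) (c : Word m) : {k // k ∉ X} → ZMod 2 :=
  fun k => c k

/-- The shortened code `C_S(I, Y)`. -/
def shortenedCode {m : ℕ} (I : Finset (Mon m)) (Y : Finset (Fin (2 ^ m))) :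
    Set ({k // k ∉ Y} → ZMod 2) :=
  {v | ∃ c ∈ code I, (∀ k ∈ Y, c k = 0) ∧ v = removePos Y c}

/-- The shortened code `C_S(I, Y)` is decreasing: the union of `I` and of the set of the monomials
whose index lies in `Y` is decreasing. -/
def ShortenedDecreasing {m : ℕ} (I : Finset (Mon m)) (Y : Finset (Fin (2 ^ m))) : Prop :=
  Decreasing (I ∪ Finset.univ.filter fun f => Mon.index f ∈ Y)

/-- The number of words of weight `d` in a set of words. -/
noncomputable def numWeight {ι : Type*} [Fintype ι] (d : ℕ) (C : Set (ι → ZMod 2)) : ℕ :=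
  {c ∈ C | hammingNorm c = d}.ncard

/-- The first `i` positions. -/
def firstPos (m i : ℕ) : Finset (Fin (2 ^ m)) := Finset.univ.filter fun k => (k : ℕ) < i

/-- The last `i` positions. -/
def lastPos (m i : ℕ) : Finset (Fin (2 ^ m)) := Finset.univ.filter fun k => 2 ^ m ≤ (k : ℕ) + i

/-- `T(f)`, formed in the code with information set `J`: the polynomials with all their monomials
in `J` whose nonzero coefficient of lowest index is that of `f` and which have the weight of `f`. -/
def T {m : ℕ} (J : Finset (Mon m)) (f : Mon m) : Set (Poly m) :=
  {p | (∀ g, Mon.index g < Mon.index f → p g = 0) ∧ p f = 1 ∧ (∀ g, g ∉ J → p g = 0) ∧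
    hammingNorm (Poly.ev p) = hammingNorm (Mon.ev f)}

/-- `T_P(f, X)`: the words of `T(f)` punctured at the positions in `X`. -/
def TP {m : ℕ} (J : Finset (Mon m)) (f : Mon m) (X : Finset (Fin (2 ^ m))) :
    Set ({k // k ∉ X} → ZMod 2) :=
  {v | ∃ p ∈ T J f, v = removePos X (Poly.ev p)}

/-- `T_S(f, Y)`: the words of `T(f)` that vanish on `Y`, shortened at the positions in `Y`. -/
def TS {m : ℕ} (J : Finset (Mon m)) (f : Mon m) (Y : Finset (Fin (2 ^ m))) :
    Set ({k // k ∉ Y} → ZMod 2) :=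
  {v | ∃ p ∈ T J f, (∀ k ∈ Y, Poly.ev p k = 0) ∧ v = removePos Y (Poly.ev p)}

/-- `P_f(d, i)`: the number of words of weight `d` in `T_P(f, X)`, with `X` the first `i`
positions. -/
noncomputable def P {m : ℕ} (J : Finset (Mon m)) (f : Mon m) (d i : ℕ) : ℕ :=
  numWeight d (TP J f (firstPos m i))

end PolarShortening

namespace PolarShortening

/-! A polynomial of degree at most `r` and weight `2 ^ (m - r)` has one monomial `f` of degree `r`
that dominates all its other monomials (`Poly.exists_dom`). Domination implies `≼` and reverses the
index order, so `f` is the leading monomial, and any decreasing set containing `f` contains all the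
monomials. Minimum weight polynomials are thus partitioned by their leading monomial.

To find `f`, variables are adjoined in increasing order and `s = s₀ + x_a s₁` is split at the newest
one. If `s₁ ≠ 0`, minimality forces `s₁` to have minimum weight and to contain the support of `s₀`;
then `s₀ = s₁ l` with `l` affine (`exists_eq_mul_of_mul_eq`). If `f` dominates `s₁`, then `x_a f`
dominates `s`, because `a` is larger than every variable of `l`.

For shortening, a polynomial vanishing on the last `i` positions has zero coefficients at the
monomials indexed there, so in a decreasing shortened code each `T(f)` contributes all its
polynomials that vanish on `Y_i` (`shortenedPolys_eq`). The translation `a ↦ a + 1` reverses the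
positions and preserves `T(f)`, which exchanges `Y_i` and `X_i`. A word punctured on `X_i` keeps its
full weight exactly when it vanishes there; this gives `P_f`. -/

variable {m : ℕ}

/-! ### The order on monomials by counting -/

/-- `g` is dominated by `f`: above every threshold `f` has at least as many variables as `g`. -/
def Dom (g f : Mon m) : Prop :=
  ∀ t : Fin m, (g.filter (t ≤ ·)).card ≤ (f.filter (t ≤ ·)).card

theorem Dom.refl (f : Mon m) : Dom f f := fun _ => le_rfl

theorem Dom.of_subset {g f : Mon m} (h : g ⊆ f) : Dom g f := fun _ =>
  Finset.card_le_card (Finset.filter_subset_filter _ h)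

theorem Dom.card_le {g f : Mon m} (h : Dom g f) : g.card ≤ f.card := by
  rcases g.eq_empty_or_nonempty with rfl | hg
  · simp
  · have h1 := h (g.min' hg)
    rw [Finset.filter_true_of_mem fun x hx => g.min'_le x hx] at h1
    exact h1.trans (Finset.card_filter_le _ _)

/-- While `g` is too large, its smallest variable can be dropped: thresholds above it see no change,
and thresholds up to it still count `g.card - 1 ≥ f.card` variables. -/
theorem Dom.exists_subset {f g : Mon m} (h : Dom f g) :
    ∃ g' ⊆ g, g'.card = f.card ∧ Dom f g' := by
  induction g using Finset.strongInduction with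
  | H g ih =>
    rcases h.card_le.eq_or_lt with hc | hc
    · exact ⟨g, subset_rfl, hc.symm, h⟩
    · have hg : g.Nonempty := Finset.card_pos.mp (by omega)
      have hm := g.min'_mem hg
      obtain ⟨g', h1, h2, h3⟩ := ih (g.erase (g.min' hg)) (Finset.erase_ssubset hm) fun t => by
        by_cases ht : t ≤ g.min' hg
        · rw [Finset.filter_true_of_mem (s := g.erase _) fun x hx =>
            ht.trans (g.min'_le x (Finset.mem_of_mem_erase hx)), Finset.card_erase_of_mem hm]
          exact (Finset.card_filter_le _ _).trans (by omega)
        · rw [Finset.filter_erase, Finset.erase_eq_of_notMem (by simp [ht])]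
          exact h t
      exact ⟨g', h1.trans (Finset.erase_subset _ _), h2, h3⟩

theorem Dom.le {f g : Mon m} (h : Dom f g) : Mon.LE f g := by
  obtain ⟨g', hg, hc, hd⟩ := h.exists_subset
  refine ⟨g', hg, hc, fun l => ?_⟩
  -- If the `l`-th variable of `f` exceeds that of `g'`, then, with that variable of `f` as
  -- threshold, `f` has all positions from `l` on, but `g'` only those after `l`.
  by_contra! hl
  have h1 : (Finset.Ici l).card ≤ (f.filter (f.orderEmbOfFin rfl l ≤ ·)).card := by
    rw [← Finset.card_map (f.orderEmbOfFin rfl).toEmbedding]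
    refine Finset.card_le_card fun x hx => ?_
    obtain ⟨j, hj, rfl⟩ := Finset.mem_map.mp hx
    exact Finset.mem_filter.mpr ⟨f.orderEmbOfFin_mem rfl j,
      (f.orderEmbOfFin rfl).monotone (Finset.mem_Ici.mp hj)⟩
  have h2 : (g'.filter (f.orderEmbOfFin rfl l ≤ ·)).card ≤ (Finset.Ioi l).card := by
    rw [← Finset.card_map (g'.orderEmbOfFin hc).toEmbedding]
    refine Finset.card_le_card fun x hx => ?_
    obtain ⟨hx, hlx⟩ := Finset.mem_filter.mp hx
    obtain ⟨j, rfl⟩ : x ∈ Set.range (g'.orderEmbOfFin hc) := by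
      rw [Finset.range_orderEmbOfFin]; exact hx
    refine Finset.mem_map_of_mem _ (Finset.mem_Ioi.mpr ?_)
    exact (g'.orderEmbOfFin hc).lt_iff_lt.mp (hl.trans_le hlx)
  have h3 := hd (f.orderEmbOfFin rfl l)
  rw [Fin.card_Ici] at h1
  rw [Fin.card_Ioi] at h2
  have := l.2
  omega

/-- A threshold up to `a` counts the new variable `a` on the right, which pays for `h`; a threshold
not below `a` in this sense misses `h` altogether. -/
theorem Dom.union_insert {g f h : Mon m} {a : Fin m} (hgf : Dom g f) (hfa : a ∉ f)
    (hha : ∀ x ∈ h, x ≤ a) (hh : h.card ≤ 1) : Dom (g ∪ h) (insert a f) := fun t => by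
  rw [Finset.filter_union, Finset.filter_insert]
  refine (Finset.card_union_le _ _).trans ?_
  split_ifs with ht
  · rw [Finset.card_insert_of_notMem (by simp [hfa])]
    exact add_le_add (hgf t) ((Finset.card_filter_le _ _).trans hh)
  · rw [Finset.filter_false_of_mem (s := h) fun x hx hx' => ht (hx'.trans (hha x hx))]
    simpa using hgf t

/-! ### Indices -/

theorem zmod_two_eq (z : ZMod 2) : z = 0 ∨ z = 1 := by revert z; decide

/-- The point whose coordinates are `1` exactly on `g`. -/
def indicator (g : Mon m) : Fin m → ZMod 2 := fun t => if t ∈ g then 1 else 0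

theorem index_injective : Function.Injective (Mon.index (m := m)) := fun f g h => by
  have h := (D m).injective h
  ext t
  have := congrFun h t
  by_cases h1 : t ∈ f <;> by_cases h2 : t ∈ g <;> simp_all

/-- The index is the binary complement of the number whose binary digits are given by `f`. -/
theorem index_add_sum (f : Mon m) : (Mon.index f : ℕ) + ∑ t ∈ f, 2 ^ (t : ℕ) =
    ∑ t : Fin m, 2 ^ (t : ℕ) := by
  rw [Mon.index, D_val, ← Finset.sum_filter_add_sum_filter_not Finset.univ (· ∈ f)]
  rw [← Finset.sum_filter_add_sum_filter_not (s := Finset.univ) (p := (· ∈ f))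
    (f := fun t : Fin m => 2 ^ (t : ℕ))]
  rw [Finset.sum_eq_zero (s := Finset.univ.filter (· ∈ f))]
  · rw [zero_add, add_comm, Finset.filter_univ_mem]
    congr 1
    refine Finset.sum_congr rfl fun t ht => ?_
    rw [if_neg (Finset.mem_filter.mp ht).2]
    simp [ZMod.val_one]
  · intro t ht
    rw [if_pos (Finset.mem_filter.mp ht).2]
    rw [show (1 + 1 : ZMod 2) = 0 from rfl]
    simp

theorem Dom.index_le {g f : Mon m} (h : Dom g f) : Mon.index f ≤ Mon.index g := by
  have hs : ∑ t ∈ g, 2 ^ (t : ℕ) ≤ ∑ t ∈ f, 2 ^ (t : ℕ) := by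
    -- Colexicographic order compares these binary numbers. If some `t ∈ g \ f` had no larger
    -- element of `f \ g` to compensate, then from `t` on `f` would be strictly contained in `g`,
    -- against domination.
    have key : toColex g ≤ toColex f := by
      rw [Finset.Colex.toColex_le_toColex]
      intro t htg htf
      by_contra! hb
      have hsub : (f.filter (t ≤ ·)).card < (g.filter (t ≤ ·)).card := by
        refine Finset.card_lt_card ⟨fun x hx => ?_, fun hc => htf ?_⟩
        · obtain ⟨hx, htx⟩ := Finset.mem_filter.mp hx
          refine Finset.mem_filter.mpr ⟨?_, htx⟩
          by_contra hxg
          exact absurd htx (not_le.mpr (hb x hx hxg))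
        · exact (Finset.mem_filter.mp (hc (Finset.mem_filter.mpr ⟨htg, le_rfl⟩))).1
      exact absurd (h t) (not_le.mpr hsub)
    rw [← Finset.Colex.toColex_image_le_toColex_image Fin.val_strictMono,
      ← Finset.geomSum_le_geomSum_iff_toColex_le_toColex le_rfl] at key
    simpa [Finset.sum_image Fin.val_injective.injOn] using key
  have h1 := index_add_sum f
  have h2 := index_add_sum g
  rw [Fin.le_def]
  omega

/-! ### Functions spanned by monomials -/

/-- Functions on `𝔽₂ᵐ`. -/
abbrev Fn (m : ℕ) : Type := (Fin m → ZMod 2) → ZMod 2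

theorem eval_eq_ite (f : Mon m) (a : Fin m → ZMod 2) :
    Mon.eval f a = if ∀ t ∈ f, a t = 1 then 1 else 0 := by
  unfold Mon.eval
  split_ifs with h
  · exact Finset.prod_eq_one h
  · push Not at h
    obtain ⟨t, ht, h1⟩ := h
    exact Finset.prod_eq_zero ht ((zmod_two_eq _).resolve_right h1)

theorem eval_mul (f g : Mon m) : Mon.eval f * Mon.eval g = Mon.eval (f ∪ g) := by
  funext a
  simp only [Pi.mul_apply, eval_eq_ite, Finset.mem_union, or_imp, forall_and]
  split_ifs <;> simp_all

/-- The functions spanned by the monomials of `S`. -/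
def monSpan (S : Set (Mon m)) : Submodule (ZMod 2) (Fn m) :=
  Submodule.span (ZMod 2) (Mon.eval '' S)

theorem eval_mem_monSpan {S : Set (Mon m)} {f : Mon m} (h : f ∈ S) : Mon.eval f ∈ monSpan S :=
  Submodule.subset_span ⟨f, h, rfl⟩

theorem monSpan_mono {S T : Set (Mon m)} (h : S ⊆ T) : monSpan S ≤ monSpan T :=
  Submodule.span_mono (Set.image_mono h)

theorem mul_mem_monSpan {S T U : Set (Mon m)} (h : ∀ f ∈ S, ∀ g ∈ T, f ∪ g ∈ U) {φ ψ : Fn m}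
    (hφ : φ ∈ monSpan S) (hψ : ψ ∈ monSpan T) : φ * ψ ∈ monSpan U := by
  have := Submodule.mul_mem_mul hφ hψ
  rw [monSpan, monSpan, Submodule.span_mul_span] at this
  refine Submodule.span_mono ?_ this
  rintro _ ⟨_, ⟨f, hf, rfl⟩, _, ⟨g, hg, rfl⟩, rfl⟩
  exact ⟨f ∪ g, h f hf g hg, (eval_mul f g).symm⟩

/-- `φ` does not depend on the variable `a`. -/
def Indep (a : Fin m) (φ : Fn m) : Prop := ∀ x b, φ (Function.update x a b) = φ x

theorem indep_of_mem_monSpan {S : Set (Mon m)} {a : Fin m} (h : ∀ f ∈ S, a ∉ f) {φ : Fn m}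
    (hφ : φ ∈ monSpan S) : Indep a φ := fun x b => by
  induction hφ using Submodule.span_induction with
  | mem φ h1 =>
    obtain ⟨f, hf, rfl⟩ := h1
    exact Finset.prod_congr rfl fun t ht =>
      Function.update_of_ne (ne_of_mem_of_not_mem ht (h f hf)) _ _
  | zero => rfl
  | add φ ψ _ _ h1 h2 => simp only [Pi.add_apply, h1, h2]
  | smul c φ _ h1 => simp only [Pi.smul_apply, h1]

theorem exists_split_of_mem_monSpan {S : Set (Mon m)} (a : Fin m) {φ : Fn m} (hφ : φ ∈ monSpan S) :
    ∃ φ₀ ∈ monSpan {f | f ∈ S ∧ a ∉ f}, ∃ φ₁ ∈ monSpan {f | insert a f ∈ S ∧ a ∉ f},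
      φ = φ₀ + Mon.eval {a} * φ₁ := by
  induction hφ using Submodule.span_induction with
  | mem φ h1 =>
    obtain ⟨f, hf, rfl⟩ := h1
    by_cases ha : a ∈ f
    · refine ⟨0, zero_mem _, Mon.eval (f.erase a), eval_mem_monSpan ?_, ?_⟩
      · simp [Finset.insert_erase ha, hf]
      · rw [eval_mul, zero_add, ← Finset.insert_eq, Finset.insert_erase ha]
    · exact ⟨Mon.eval f, eval_mem_monSpan ⟨hf, ha⟩, 0, zero_mem _, by simp⟩
  | zero => exact ⟨0, zero_mem _, 0, zero_mem _, by simp⟩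
  | add φ ψ _ _ h1 h2 =>
    obtain ⟨φ₀, h3, φ₁, h4, rfl⟩ := h1
    obtain ⟨ψ₀, h5, ψ₁, h6, rfl⟩ := h2
    exact ⟨_, add_mem h3 h5, _, add_mem h4 h6, by ring⟩
  | smul c φ _ h1 =>
    obtain ⟨φ₀, h3, φ₁, h4, rfl⟩ := h1
    exact ⟨_, Submodule.smul_mem _ c h3, _, Submodule.smul_mem _ c h4, by
      rw [smul_add, mul_smul_comm]⟩

theorem Indep.add {a : Fin m} {φ ψ : Fn m} (hφ : Indep a φ) (hψ : Indep a ψ) : Indep a (φ + ψ) :=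
  fun x b => by simp only [Pi.add_apply, hφ x b, hψ x b]

theorem split_update {a : Fin m} {φ₀ φ₁ : Fn m} (h₀ : Indep a φ₀) (h₁ : Indep a φ₁)
    (x : Fin m → ZMod 2) (b : ZMod 2) :
    (φ₀ + Mon.eval {a} * φ₁) (Function.update x a b) = φ₀ x + b * φ₁ x := by
  simp only [Pi.add_apply, Pi.mul_apply, h₀ x b, h₁ x b, Mon.eval, Finset.prod_singleton,
    Function.update_self]

/-- The slices `x_a = 0` and `x_a = 1` carry `φ₀` and `φ₀ + φ₁`. Norms are taken over all of `𝔽₂ᵐ`,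
where each slice function is counted twice; hence the factor 2. -/
theorem hammingNorm_split {a : Fin m} {φ₀ φ₁ : Fn m} (h₀ : Indep a φ₀) (h₁ : Indep a φ₁) :
    hammingNorm (φ₀ + Mon.eval {a} * φ₁) * 2 = hammingNorm φ₀ + hammingNorm (φ₀ + φ₁) := by
  have key (F : (Fin m → ZMod 2) → ℕ) : (∑ x, F x) * 2 =
      ∑ x, F (Function.update x a 0) + ∑ x, F (Function.update x a 1) := by
    have h : ∑ x, F (x + Pi.single a 1) = ∑ x, F x :=
      Equiv.sum_comp (Equiv.addRight (Pi.single a 1)) F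
    rw [mul_two]
    nth_rw 2 [← h]
    rw [← Finset.sum_add_distrib, ← Finset.sum_add_distrib]
    refine Finset.sum_congr rfl fun x _ => ?_
    have h2 : x + Pi.single a 1 = Function.update x a (x a + 1) := by
      ext t
      rcases eq_or_ne t a with rfl | ht
      · simp
      · simp [ht]
    have h3 : Function.update x a (x a) = x := Function.update_eq_self a x
    rcases zmod_two_eq (x a) with hx | hx <;> rw [hx] at h2 h3
    · rw [h2, h3, zero_add]
    · rw [h2, h3, add_comm, show (1 + 1 : ZMod 2) = 0 from rfl]
  simp only [hammingNorm, Finset.card_filter]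
  rw [key]
  simp only [split_update h₀ h₁, zero_mul, one_mul, add_zero, Pi.add_apply]

theorem hammingNorm_add_le {ι : Type*} [Fintype ι] (φ ψ : ι → ZMod 2) :
    hammingNorm ψ ≤ hammingNorm φ + hammingNorm (φ + ψ) := by
  simp only [hammingNorm, Finset.card_filter, ← Finset.sum_add_distrib, Pi.add_apply]
  refine Finset.sum_le_sum fun x _ => ?_
  rcases zmod_two_eq (φ x) with h | h <;> rcases zmod_two_eq (ψ x) with h1 | h1 <;> simp [h, h1]

/-- Equality in the triangle inequality for `ψ = φ + (φ + ψ)` must hold pointwise, which excludes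
points with `φ = 1` and `ψ = 0`. -/
theorem mul_eq_of_hammingNorm_add_eq {ι : Type*} [Fintype ι] {φ ψ : ι → ZMod 2}
    (h : hammingNorm φ + hammingNorm (φ + ψ) ≤ hammingNorm ψ) : φ * ψ = φ := by
  have h' := (hammingNorm_add_le φ ψ).antisymm h
  simp only [hammingNorm, Finset.card_filter, ← Finset.sum_add_distrib, Pi.add_apply] at h'
  rw [Finset.sum_eq_sum_iff_of_le] at h'
  · funext x
    have := h' x (Finset.mem_univ x)
    rw [Pi.mul_apply]
    rcases zmod_two_eq (φ x) with h | h <;> rcases zmod_two_eq (ψ x) with h1 | h1 <;> simp_all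
  · intro x _
    rcases zmod_two_eq (φ x) with h | h <;> rcases zmod_two_eq (ψ x) with h1 | h1 <;> simp_all

theorem hammingNorm_le_of_mul_eq {ι : Type*} [Fintype ι] {φ ψ : ι → ZMod 2} (h : φ * ψ = φ) :
    hammingNorm φ ≤ hammingNorm ψ := by
  refine Finset.card_le_card fun x hx => ?_
  simp only [Finset.mem_filter, Finset.mem_univ, true_and] at hx ⊢
  intro h0
  have := congrFun h x
  rw [Pi.mul_apply, h0, mul_zero] at this
  exact hx this.symm

/-! ### Words of minimum weight of Reed–Muller codes -/

/-- The functions of degree less than `k` in the variables of `V`. -/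
def rm (V : Finset (Fin m)) (k : ℕ) : Submodule (ZMod 2) (Fn m) :=
  monSpan {f | f ⊆ V ∧ f.card < k}

/-- The strict degree bound makes `k = 0` the zero space, which rules out `s₁ ≠ 0` at the bottom of
the inductions on degree. -/
theorem rm_zero (V : Finset (Fin m)) : rm V 0 = ⊥ := by simp [rm, monSpan]

theorem rm_mono {V W : Finset (Fin m)} (h : V ⊆ W) (k : ℕ) : rm V k ≤ rm W k :=
  monSpan_mono fun _ hf => ⟨hf.1.trans h, hf.2⟩

theorem indep_of_mem_rm {V : Finset (Fin m)} {a : Fin m} (ha : a ∉ V) {k : ℕ} {φ : Fn m}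
    (h : φ ∈ rm V k) : Indep a φ :=
  indep_of_mem_monSpan (fun _ hf h' => ha (hf.1 h')) h

theorem exists_split_of_mem_rm {V : Finset (Fin m)} {a : Fin m} {k : ℕ} {φ : Fn m}
    (h : φ ∈ rm (insert a V) (k + 1)) :
    ∃ φ₀ ∈ rm V (k + 1), ∃ φ₁ ∈ rm V k, φ = φ₀ + Mon.eval {a} * φ₁ := by
  obtain ⟨φ₀, h₀, φ₁, h₁, rfl⟩ := exists_split_of_mem_monSpan a h
  refine ⟨φ₀, monSpan_mono ?_ h₀, φ₁, monSpan_mono ?_ h₁, rfl⟩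
  · rintro f ⟨⟨hf, hc⟩, ha⟩
    exact ⟨(Finset.subset_insert_iff_of_notMem ha).mp hf, hc⟩
  · rintro f ⟨⟨hf, hc⟩, ha⟩
    rw [Finset.card_insert_of_notMem ha] at hc
    exact ⟨(Finset.insert_subset_insert_iff ha).mp hf, by omega⟩

theorem add_mul_mem_rm {V : Finset (Fin m)} {a : Fin m} {k : ℕ} {φ₀ φ₁ : Fn m}
    (h₀ : φ₀ ∈ rm V (k + 1)) (h₁ : φ₁ ∈ rm V k) :
    φ₀ + Mon.eval {a} * φ₁ ∈ rm (insert a V) (k + 1) := by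
  refine add_mem (rm_mono (Finset.subset_insert a V) _ h₀) ?_
  refine mul_mem_monSpan ?_ (eval_mem_monSpan (Set.mem_singleton {a})) h₁
  rintro _ rfl f ⟨hf, hc⟩
  rw [← Finset.insert_eq]
  exact ⟨Finset.insert_subset_insert a hf, (Finset.card_insert_le a f).trans_lt (by omega)⟩

theorem eq_one_of_mem_rm_empty {k : ℕ} {φ : Fn m} (h : φ ∈ rm ∅ k) (h0 : φ ≠ 0) : φ = 1 := by
  have h1 : φ ∈ Submodule.span (ZMod 2) {(1 : Fn m)} := by
    refine Submodule.span_mono ?_ h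
    rintro _ ⟨f, ⟨hf, -⟩, rfl⟩
    rw [Finset.subset_empty.mp hf]
    exact funext fun _ => Finset.prod_empty
  obtain ⟨c, rfl⟩ := Submodule.mem_span_singleton.mp h1
  rcases zmod_two_eq c with rfl | rfl
  · simp at h0
  · simp

theorem hammingNorm_one : hammingNorm (1 : Fn m) = 2 ^ m := by
  simp [hammingNorm, ZMod.card]

/-- The Reed–Muller minimum distance: the two slices of `φ` differ by `φ₁`, so twice the weight of
`φ` is at least that of `φ₁`, whose degree bound is one lower. -/
theorem two_pow_le_hammingNorm_mul (V : Finset (Fin m)) : ∀ (k : ℕ) (φ : Fn m),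
    φ ∈ rm V (k + 1) → φ ≠ 0 → 2 ^ m ≤ hammingNorm φ * 2 ^ k := by
  induction V using Finset.induction_on with
  | empty =>
    intro k φ h h0
    rw [eq_one_of_mem_rm_empty h h0, hammingNorm_one]
    exact Nat.le_mul_of_pos_right _ (by positivity)
  | insert a V ha ih =>
    intro k φ h h0
    obtain ⟨φ₀, h₀, φ₁, h₁, rfl⟩ := exists_split_of_mem_rm h
    rcases eq_or_ne φ₁ 0 with rfl | h10
    · rw [mul_zero, add_zero] at h0 ⊢
      exact ih k φ₀ h₀ h0
    · rcases k with - | k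
      · rw [rm_zero] at h₁
        exact absurd h₁ h10
      have h2 := hammingNorm_split (indep_of_mem_rm ha h₀) (indep_of_mem_rm ha h₁)
      refine (ih k φ₁ h₁ h10).trans ?_
      rw [pow_succ', ← mul_assoc, h2]
      exact Nat.mul_le_mul_right _ (hammingNorm_add_le φ₀ φ₁)

/-- A minimum weight function `s₀ + x_a s₁` with `s₁ ≠ 0`: then `s₁` has minimum weight, and its
support contains that of `s₀`. -/
theorem min_weight_split {V : Finset (Fin m)} {a : Fin m} (ha : a ∉ V) {k : ℕ} {s₀ s₁ : Fn m}
    (h₀ : s₀ ∈ rm V (k + 2)) (h₁ : s₁ ∈ rm V (k + 1)) (h10 : s₁ ≠ 0)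
    (hw : hammingNorm (s₀ + Mon.eval {a} * s₁) * 2 ^ (k + 1) = 2 ^ m) :
    hammingNorm s₁ * 2 ^ k = 2 ^ m ∧ s₀ * s₁ = s₀ := by
  have h2 := hammingNorm_split (indep_of_mem_rm ha h₀) (indep_of_mem_rm ha h₁)
  rw [pow_succ', ← mul_assoc, h2] at hw
  have h3 := two_pow_le_hammingNorm_mul V k s₁ h₁ h10
  have h4 := Nat.mul_le_mul_right (2 ^ k) (hammingNorm_add_le s₀ s₁)
  refine ⟨by omega, mul_eq_of_hammingNorm_add_eq ?_⟩
  exact Nat.le_of_mul_le_mul_right (hw.le.trans h3) (by positivity)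

theorem mul_split_eq {a : Fin m} {q₀ q₁ s₀ s₁ : Fn m} (hq₀ : Indep a q₀) (hq₁ : Indep a q₁)
    (hs₀ : Indep a s₀) (hs₁ : Indep a s₁)
    (h : (q₀ + Mon.eval {a} * q₁) * (s₀ + Mon.eval {a} * s₁) = q₀ + Mon.eval {a} * q₁)
    (x : Fin m → ZMod 2) :
    q₀ x * s₀ x = q₀ x ∧ (q₀ x + q₁ x) * (s₀ x + s₁ x) = q₀ x + q₁ x := by
  have h0 := congrFun h (Function.update x a 0)
  have h1 := congrFun h (Function.update x a 1)
  rw [Pi.mul_apply, split_update hq₀ hq₁, split_update hs₀ hs₁] at h0 h1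
  simpa using And.intro h0 h1

/-- A function whose support lies in that of a minimum weight function `s` is a multiple of `s` by a
function of complementary degree. -/
theorem exists_eq_mul_of_mul_eq (V : Finset (Fin m)) : ∀ (k e : ℕ) (s q : Fn m),
    s ∈ rm V (k + 1) → hammingNorm s * 2 ^ k = 2 ^ m → q ∈ rm V (k + e) → q * s = q →
      ∃ l ∈ rm V e, q = s * l := by
  -- The case `e = 0`: a nonzero `q` of degree less than `k` would weigh at least twice as much as
  -- `s`, whose support contains its own.
  have base (V : Finset (Fin m)) (k : ℕ) (s q : Fn m) (hw : hammingNorm s * 2 ^ k = 2 ^ m)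
      (hq : q ∈ rm V k) (hqs : q * s = q) : q = 0 := by
    by_contra h0
    rcases k with - | k
    · rw [rm_zero] at hq
      exact h0 hq
    have h1 := two_pow_le_hammingNorm_mul V k q hq h0
    have h2 := Nat.mul_le_mul_right (2 ^ k) (hammingNorm_le_of_mul_eq hqs)
    rw [pow_succ', mul_left_comm] at hw
    have : 0 < 2 ^ m := by positivity
    omega
  induction V using Finset.induction_on with
  | empty =>
    intro k e s q hs hw hq hqs
    rcases eq_or_ne q 0 with rfl | h0
    · exact ⟨0, zero_mem _, by simp⟩
    rcases e with - | e
    · exact absurd (base ∅ k s q hw hq hqs) h0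
    refine ⟨1, ?_, ?_⟩
    · have : Mon.eval (∅ : Mon m) ∈ rm ∅ (e + 1) := eval_mem_monSpan (by simp)
      rwa [show Mon.eval (∅ : Mon m) = 1 from funext fun _ => Finset.prod_empty] at this
    · rw [eq_one_of_mem_rm_empty hq h0, one_mul] at hqs
      rw [eq_one_of_mem_rm_empty hq h0, hqs, one_mul]
  | insert a V ha ih =>
    intro k e s q hs hw hq hqs
    rcases e with - | e
    · exact ⟨0, zero_mem _, by rw [base _ k s q hw hq hqs, mul_zero]⟩
    obtain ⟨s₀, hs₀, s₁, hs₁, rfl⟩ := exists_split_of_mem_rm hs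
    obtain ⟨q₀, hq₀, q₁, hq₁, rfl⟩ := exists_split_of_mem_rm (k := k + e) hq
    have hx := mul_split_eq (indep_of_mem_rm ha hq₀) (indep_of_mem_rm ha hq₁)
      (indep_of_mem_rm ha hs₀) (indep_of_mem_rm ha hs₁) hqs
    rcases eq_or_ne s₁ 0 with rfl | h10
    · simp only [Pi.zero_apply, add_zero, mul_zero] at hx hw ⊢
      obtain ⟨l₀, hl₀, e₀⟩ := ih k (e + 1) s₀ q₀ hs₀ hw hq₀ (funext fun x => (hx x).1)
      obtain ⟨l₁, hl₁, e₁⟩ := ih k e s₀ q₁ hs₀ hw hq₁ (funext fun x => by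
        have := hx x
        rw [add_mul, this.1] at this
        exact add_left_cancel this.2)
      exact ⟨_, add_mul_mem_rm hl₀ hl₁, by rw [e₀, e₁]; ring⟩
    · rcases k with - | k
      · rw [rm_zero] at hs₁
        exact absurd hs₁ h10
      obtain ⟨hw₁, h01⟩ := min_weight_split ha hs₀ hs₁ h10 hw
      have h01 (x) : s₀ x * s₁ x = s₀ x := congrFun h01 x
      -- As `s₀` lies in `s₁`, the slices `s₀` and `s₀ + s₁` partition the support of `s₁`, and the
      -- slices of `q` lie in these parts. So `q₁` lies in `s₁`, and `q₁ = s₁ l` restricted to `s₀`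
      -- gives `q₀ = s₀ l`.
      obtain ⟨l, hl, e₁⟩ := ih k (e + 1) s₁ q₁ hs₁ hw₁
        (by rwa [show k + (e + 1) = k + 1 + e by ring]) (funext fun x => by
          have := hx x
          have h := h01 x
          rw [Pi.mul_apply]
          revert this h
          generalize q₀ x = u, q₁ x = v, s₀ x = w, s₁ x = z
          revert u v w z; decide)
      refine ⟨l, rm_mono (Finset.subset_insert a V) _ hl, ?_⟩
      funext x
      have h1 := hx x
      have h2 := h01 x
      have h3 : q₁ x = s₁ x * l x := congrFun e₁ x
      simp only [Pi.add_apply, Pi.mul_apply]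
      revert h1 h2 h3
      generalize Mon.eval {a} x = y, q₀ x = u, q₁ x = v, s₀ x = w, s₁ x = z, l x = t
      revert u v w z y t; decide

/-- The monomials of a minimum weight function are dominated by one of its monomials. -/
theorem exists_add_mem_monSpan_dom (V : Finset (Fin m)) : ∀ (k : ℕ) (s : Fn m),
    s ∈ rm V (k + 1) → hammingNorm s * 2 ^ k = 2 ^ m →
      ∃ f ⊆ V, f.card = k ∧ s + Mon.eval f ∈ monSpan {g | g ⊆ V ∧ Dom g f ∧ g ≠ f} := by
  -- The variable split off must exceed all others for `Dom.union_insert` to apply.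
  induction V using Finset.induction_on_max with
  | empty =>
    intro k s hs hw
    have h0 : s ≠ 0 := by
      rintro rfl
      rw [hammingNorm_zero, zero_mul] at hw
      exact absurd hw.symm (by positivity)
    rw [eq_one_of_mem_rm_empty hs h0] at hw ⊢
    refine ⟨∅, subset_rfl, ?_, ?_⟩
    · rw [hammingNorm_one] at hw
      have : 2 ^ k = 1 := Nat.eq_of_mul_eq_mul_left (by positivity : 0 < 2 ^ m) (by rw [hw, mul_one])
      rcases k with - | k
      · rfl
      · rw [pow_succ] at this; omega
    · have : (1 : Fn m) + Mon.eval ∅ = 0 := by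
        funext x
        simp only [Pi.add_apply, Pi.one_apply, Mon.eval, Finset.prod_empty]
        rfl
      rw [this]
      exact zero_mem _
  | insert a V hV ih =>
    intro k s hs hw
    have ha : a ∉ V := fun h => (hV a h).false
    obtain ⟨s₀, hs₀, s₁, hs₁, rfl⟩ := exists_split_of_mem_rm hs
    rcases eq_or_ne s₁ 0 with rfl | h10
    · rw [mul_zero, add_zero] at hw ⊢
      obtain ⟨f, hf, hc, h⟩ := ih k s₀ hs₀ hw
      refine ⟨f, hf.trans (Finset.subset_insert a V), hc, monSpan_mono ?_ h⟩
      exact fun g hg => ⟨hg.1.trans (Finset.subset_insert a V), hg.2⟩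
    · rcases k with - | k
      · rw [rm_zero] at hs₁
        exact absurd hs₁ h10
      obtain ⟨hw₁, h01⟩ := min_weight_split ha hs₀ hs₁ h10 hw
      -- The value `e = 2` means that `l` has degree at most one, so each of its monomials adds at
      -- most one variable.
      obtain ⟨l, hl, e⟩ := exists_eq_mul_of_mul_eq V k 2 s₁ s₀ hs₁ hw₁ hs₀ h01
      obtain ⟨f, hf, hc, h⟩ := ih k s₁ hs₁ hw₁
      have haf : a ∉ f := fun h => ha (hf h)
      refine ⟨insert a f, Finset.insert_subset_insert a hf, by
        rw [Finset.card_insert_of_notMem haf, hc], ?_⟩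
      have h₁ : s₁ ∈ monSpan {g | g ⊆ V ∧ Dom g f} := by
        have h2 : s₁ = (s₁ + Mon.eval f) + Mon.eval f := by
          rw [add_assoc, CharTwo.add_self_eq_zero, add_zero]
        rw [h2]
        refine add_mem (monSpan_mono ?_ h) (eval_mem_monSpan ⟨hf, Dom.refl f⟩)
        exact fun g hg => ⟨hg.1, hg.2.1⟩
      rw [add_assoc, show Mon.eval (insert a f) = Mon.eval {a} * Mon.eval f by
        rw [eval_mul, Finset.insert_eq], ← mul_add]
      refine add_mem ?_ (mul_mem_monSpan ?_ (eval_mem_monSpan (Set.mem_singleton {a})) h)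
      · rw [e]
        refine mul_mem_monSpan ?_ h₁ hl
        rintro g ⟨hg, hd⟩ j ⟨hj, hjc⟩
        refine ⟨(Finset.union_subset hg hj).trans (Finset.subset_insert a V),
          hd.union_insert haf (fun x hx => (hV x (hj hx)).le) (by omega), fun he => ha ?_⟩
        exact Finset.union_subset hg hj (he ▸ Finset.mem_insert_self a f)
      · rintro _ rfl g ⟨hg, hd, hne⟩
        rw [← Finset.insert_eq]
        refine ⟨Finset.insert_subset_insert a hg, ?_, fun he => hne ?_⟩
        · rw [Finset.insert_eq, Finset.union_comm]
          exact hd.union_insert haf (by simp) (by simp)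
        · rw [← Finset.erase_insert haf, ← he, Finset.erase_insert fun h => ha (hg h)]

/-! ### Polynomials and their coefficients -/

theorem Poly.eval_eq_sum (p : Poly m) : Poly.eval p = ∑ f, p f • Mon.eval f := by
  funext a
  simp [Poly.eval, Finset.sum_apply]

theorem Poly.eval_add (p q : Poly m) : Poly.eval (p + q) = Poly.eval p + Poly.eval q := by
  simp only [Poly.eval_eq_sum, Pi.add_apply, add_smul, Finset.sum_add_distrib]

theorem Poly.eval_single (f : Mon m) : Poly.eval (Pi.single f 1) = Mon.eval f := by
  rw [Poly.eval_eq_sum, Finset.sum_eq_single f] <;> simp +contextual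

theorem Poly.ev_index (p : Poly m) (g : Mon m) :
    Poly.ev p (Mon.index g) = Poly.eval p (indicator g) := by
  simp only [Poly.ev, Mon.index, Equiv.symm_apply_apply]
  rfl

theorem Poly.eval_indicator (p : Poly m) (g : Mon m) :
    Poly.eval p (indicator g) = ∑ f ∈ g.powerset, p f := by
  rw [Poly.eval, ← Finset.sum_subset (Finset.subset_univ g.powerset)]
  · refine Finset.sum_congr rfl fun f hf => ?_
    rw [eval_eq_ite, if_pos, mul_one]
    exact fun t ht => if_pos (Finset.mem_powerset.mp hf ht)
  · intro f _ hf
    rw [eval_eq_ite, if_neg, mul_zero]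
    refine fun h => hf (Finset.mem_powerset.mpr fun t ht => ?_)
    by_contra h'
    exact zero_ne_one ((if_neg h').symm.trans (h t ht))

/-- Möbius inversion: values at indicators are sums of coefficients over subsets. -/
theorem Poly.coeff_eq_zero (p : Poly m) (g : Mon m)
    (h : ∀ f ⊆ g, Poly.eval p (indicator f) = 0) : p g = 0 := by
  induction g using Finset.strongInduction with
  | H g ih =>
    have h1 := h g subset_rfl
    rw [Poly.eval_indicator, Finset.sum_eq_single g] at h1
    · exact h1
    · intro f hf hne
      have hf := Finset.mem_powerset.mp hf
      exact ih f (hf.ssubset_of_ne hne) fun f' h' => h f' (h'.trans hf)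
    · exact fun h' => absurd (Finset.mem_powerset_self g) h'

theorem Poly.eval_injective : Function.Injective (Poly.eval (m := m)) := fun p q h => by
  funext g
  have h0 : (p + q) g = 0 := Poly.coeff_eq_zero _ g fun f _ => by
    rw [Poly.eval_add, h, CharTwo.add_self_eq_zero, Pi.zero_apply]
  exact CharTwo.add_eq_zero.mp h0

theorem Poly.eval_eq_ev (p : Poly m) (a : Fin m → ZMod 2) : Poly.eval p a = Poly.ev p (D m a) := by
  simp [Poly.ev]

theorem Poly.ev_injective : Function.Injective (Poly.ev (m := m)) := fun p q h =>
  Poly.eval_injective (funext fun a => by rw [Poly.eval_eq_ev, h, Poly.eval_eq_ev])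

theorem hammingNorm_comp_equiv {ι κ : Type*} [Fintype ι] [Fintype κ] (e : ι ≃ κ)
    (c : κ → ZMod 2) : hammingNorm (fun i => c (e i)) = hammingNorm c := by
  simp only [hammingNorm, Finset.card_filter]
  exact Equiv.sum_comp e fun k => if c k ≠ 0 then 1 else 0

theorem hammingNorm_ev (p : Poly m) : hammingNorm (Poly.ev p) = hammingNorm (Poly.eval p) :=
  hammingNorm_comp_equiv (D m).symm (Poly.eval p)

theorem hammingNorm_monEv (f : Mon m) : hammingNorm (Mon.ev f) = 2 ^ (m - f.card) := by
  rw [show hammingNorm (Mon.ev f) = hammingNorm (Mon.eval f) from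
    hammingNorm_comp_equiv (D m).symm (Mon.eval f)]
  have h : (Finset.univ.filter fun a => Mon.eval f a ≠ 0) =
      Fintype.piFinset fun t => if t ∈ f then {1} else Finset.univ := by
    ext a
    simp only [Finset.mem_filter, Finset.mem_univ, true_and, Fintype.mem_piFinset, eval_eq_ite,
      ne_eq, ite_eq_right_iff, one_ne_zero, imp_false, not_not]
    refine forall_congr' fun t => ?_
    split_ifs with ht <;> simp [ht]
  rw [hammingNorm, h, Fintype.card_piFinset]
  simp only [apply_ite Finset.card, Finset.card_singleton, Finset.card_univ, ZMod.card]
  rw [Finset.prod_ite, Finset.prod_const_one, one_mul, Finset.prod_const,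
    Finset.filter_not, Finset.filter_univ_mem, ← Finset.compl_eq_univ_sdiff, Finset.card_compl,
    Fintype.card_fin]

theorem mem_span_image_iff {M : Type*} [AddCommGroup M] [Module (ZMod 2) M] (v : Mon m → M)
    (S : Finset (Mon m)) (x : M) : x ∈ Submodule.span (ZMod 2) (v '' (S : Set (Mon m))) ↔
      ∃ p : Poly m, (∀ g, g ∉ S → p g = 0) ∧ ∑ f, p f • v f = x := by
  rw [Submodule.mem_span_image_finset_iff_exists_fun']
  constructor
  · rintro ⟨c, rfl⟩
    exact ⟨fun g => if g ∈ S then c g else 0, fun g hg => if_neg hg, by simp [ite_smul]⟩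
  · rintro ⟨p, h, rfl⟩
    exact ⟨p, Finset.sum_subset (Finset.subset_univ S) fun g _ hg => by rw [h g hg, zero_smul]⟩

theorem mem_code_iff {I : Finset (Mon m)} {c : Word m} :
    c ∈ code I ↔ ∃ p : Poly m, (∀ g, g ∉ I → p g = 0) ∧ Poly.ev p = c := by
  rw [code, mem_span_image_iff]
  refine exists_congr fun p => and_congr_right fun _ => ?_
  rw [show ∑ f, p f • Mon.ev f = Poly.ev p from funext fun k => by
    simp [Finset.sum_apply, Poly.ev, Mon.ev, Poly.eval]]

/-- The monomials of a minimum weight polynomial are dominated by one of its monomials. -/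
theorem Poly.exists_dom {r : ℕ} {p : Poly m} (hp : ∀ g, p g ≠ 0 → g.card ≤ r)
    (hw : hammingNorm (Poly.ev p) * 2 ^ r = 2 ^ m) :
    ∃ f : Mon m, f.card = r ∧ p f = 1 ∧ ∀ g, p g ≠ 0 → Dom g f := by
  classical
  rw [hammingNorm_ev] at hw
  have h1 : Poly.eval p ∈ rm Finset.univ (r + 1) := by
    rw [Poly.eval_eq_sum]
    refine sum_mem fun g _ => ?_
    by_cases hg : p g = 0
    · rw [hg, zero_smul]
      exact zero_mem _
    · exact Submodule.smul_mem _ _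
        (eval_mem_monSpan ⟨Finset.subset_univ _, Nat.lt_succ_of_le (hp g hg)⟩)
  obtain ⟨f, -, hc, hf⟩ := exists_add_mem_monSpan_dom Finset.univ r _ h1 hw
  rw [monSpan, ← Set.coe_toFinset {g : Mon m | g ⊆ Finset.univ ∧ Dom g f ∧ g ≠ f},
    mem_span_image_iff] at hf
  obtain ⟨q, hq, he⟩ := hf
  rw [← Poly.eval_eq_sum] at he
  have hpq : p = q + Pi.single f 1 := Poly.eval_injective (by
    rw [Poly.eval_add, Poly.eval_single, he, add_assoc, CharTwo.add_self_eq_zero, add_zero])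
  refine ⟨f, hc, ?_, fun g hg => ?_⟩
  · rw [hpq, Pi.add_apply, Pi.single_eq_same, hq f (by simp), zero_add]
  · rcases eq_or_ne g f with rfl | hne
    · exact Dom.refl g
    · by_contra hd
      refine hg ?_
      rw [hpq, Pi.add_apply, Pi.single_eq_of_ne hne, hq g (by simp [hd]), zero_add]

/-! ### The translation by the all-ones point -/

/-- Adding the all-ones point flips every binary digit of the position. -/
theorem D_add_one (a : Fin m → ZMod 2) : D m (a + 1) = Fin.rev (D m a) := by
  have h : (D m (a + 1) : ℕ) + D m a = ∑ t : Fin m, 2 ^ (t : ℕ) := by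
    rw [D_val, D_val, ← Finset.sum_add_distrib]
    refine Finset.sum_congr rfl fun t _ => ?_
    rw [← mul_add, Pi.add_apply, Pi.one_apply]
    rcases zmod_two_eq (a t) with h | h <;> rw [h] <;> simp [ZMod.val_one, CharTwo.add_self_eq_zero]
  rw [Fin.sum_univ_eq_sum_range (fun t => 2 ^ t)] at h
  have h2 := Nat.geomSum_eq le_rfl m
  have h3 := (D m a).2
  ext
  rw [Fin.val_rev]
  omega

/-- The polynomial obtained by substituting `x_t + 1` for every variable `x_t`. -/
def Poly.translate (p : Poly m) : Poly m := fun g => ∑ f, if g ⊆ f then p f else 0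

theorem Poly.eval_translate (p : Poly m) (a : Fin m → ZMod 2) :
    Poly.eval (Poly.translate p) a = Poly.eval p (a + 1) := by
  simp only [Poly.eval, Poly.translate, Finset.sum_mul]
  rw [Finset.sum_comm]
  refine Finset.sum_congr rfl fun f _ => ?_
  simp only [Mon.eval, Pi.add_apply, Pi.one_apply, Finset.prod_add_one, Finset.mul_sum]
  rw [← Finset.sum_subset (Finset.subset_univ f.powerset)]
  · exact Finset.sum_congr rfl fun g hg => by rw [if_pos (Finset.mem_powerset.mp hg)]
  · intro g _ hg
    rw [if_neg (fun h => hg (Finset.mem_powerset.mpr h)), zero_mul]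

theorem Poly.ev_translate (p : Poly m) (k : Fin (2 ^ m)) :
    Poly.ev (Poly.translate p) k = Poly.ev p (Fin.rev k) := by
  rw [Poly.ev, Poly.eval_translate, Poly.eval_eq_ev, D_add_one, Equiv.apply_symm_apply]

theorem Poly.translate_translate (p : Poly m) : Poly.translate (Poly.translate p) = p :=
  Poly.ev_injective (funext fun k => by rw [Poly.ev_translate, Poly.ev_translate, Fin.rev_rev])

/-- Substitution creates only factors of existing monomials: these stay in `J`, and proper factors
have larger index, so the leading term is unchanged. The values are merely permuted. -/
theorem Poly.translate_mem_T {J : Finset (Mon m)} (hJ : Decreasing J) {f : Mon m} {p : Poly m}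
    (hp : p ∈ T J f) : Poly.translate p ∈ T J f := by
  obtain ⟨h1, h2, h3, h4⟩ := hp
  refine ⟨fun g hg => ?_, ?_, fun g hg => ?_, ?_⟩
  · refine Finset.sum_eq_zero fun h _ => ite_eq_right_iff.mpr fun hgh => h1 h ?_
    exact (Dom.of_subset hgh).index_le.trans_lt hg
  · rw [Poly.translate, Finset.sum_eq_single f]
    · rw [if_pos subset_rfl, h2]
    · refine fun h _ hne => ite_eq_right_iff.mpr fun hfh => h1 h ?_
      exact (Dom.of_subset hfh).index_le.lt_of_ne fun he => hne (index_injective he)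
    · exact fun h => absurd (Finset.mem_univ f) h
  · refine Finset.sum_eq_zero fun h _ => ite_eq_right_iff.mpr fun hgh => h3 h fun hh => hg ?_
    exact hJ g h (Dom.of_subset hgh).le hh
  · rw [← h4, show Poly.ev (Poly.translate p) = fun k => Poly.ev p (Fin.revPerm k) from
      funext (Poly.ev_translate p), hammingNorm_comp_equiv]

/-! ### Counting words -/

theorem hammingNorm_removePos_of_vanish {X : Finset (Fin (2 ^ m))} {c : Word m}
    (h : ∀ k ∈ X, c k = 0) : hammingNorm (removePos X c) = hammingNorm c := by
  rw [hammingNorm, hammingNorm, ← Finset.card_map (Function.Embedding.subtype (· ∉ X))]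
  congr 1
  ext k
  constructor
  · intro hk
    obtain ⟨j, hj, rfl⟩ := Finset.mem_map.mp hk
    exact Finset.mem_filter.mpr ⟨Finset.mem_univ _, (Finset.mem_filter.mp hj).2⟩
  · intro hk
    have hk := (Finset.mem_filter.mp hk).2
    exact Finset.mem_map.mpr ⟨⟨k, fun hX => hk (h k hX)⟩,
      Finset.mem_filter.mpr ⟨Finset.mem_univ _, hk⟩, rfl⟩

theorem vanish_of_hammingNorm_removePos {X : Finset (Fin (2 ^ m))} {c : Word m}
    (h : hammingNorm (removePos X c) = hammingNorm c) : ∀ k ∈ X, c k = 0 := by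
  intro k hk
  by_contra h0
  rw [hammingNorm, ← Finset.card_map (Function.Embedding.subtype (· ∉ X))] at h
  refine absurd h (Finset.card_lt_card ⟨fun j hj => ?_, fun hs => ?_⟩).ne
  · obtain ⟨j, hj', rfl⟩ := Finset.mem_map.mp hj
    exact Finset.mem_filter.mpr ⟨Finset.mem_univ _, (Finset.mem_filter.mp hj').2⟩
  · obtain ⟨j, -, rfl⟩ := Finset.mem_map.mp (hs (Finset.mem_filter.mpr ⟨Finset.mem_univ k, h0⟩))
    exact j.2 hk

theorem injOn_removePos_ev (X : Finset (Fin (2 ^ m))) :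
    Set.InjOn (fun p : Poly m => removePos X (Poly.ev p)) {p | ∀ k ∈ X, Poly.ev p k = 0} := by
  intro p hp q hq h
  refine Poly.ev_injective (funext fun k => ?_)
  by_cases hk : k ∈ X
  · rw [hp k hk, hq k hk]
  · exact congrFun h ⟨k, hk⟩

/-- The polynomials of `T(f)` that vanish on `X`. -/
def vanishT (J : Finset (Mon m)) (f : Mon m) (X : Finset (Fin (2 ^ m))) : Set (Poly m) :=
  {p ∈ T J f | ∀ k ∈ X, Poly.ev p k = 0}

theorem TS_eq_image (J : Finset (Mon m)) (f : Mon m) (Y : Finset (Fin (2 ^ m))) :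
    TS J f Y = (fun p => removePos Y (Poly.ev p)) '' vanishT J f Y := by
  ext v
  simp only [TS, vanishT, Set.mem_ofPred_eq, Set.mem_image, and_assoc, eq_comm (a := v)]

theorem ncard_TS (J : Finset (Mon m)) (f : Mon m) (Y : Finset (Fin (2 ^ m))) :
    (TS J f Y).ncard = (vanishT J f Y).ncard := by
  rw [TS_eq_image]
  exact ((injOn_removePos_ev Y).mono fun p hp => hp.2).ncard_image

theorem numWeight_TS (J : Finset (Mon m)) (f : Mon m) (Y : Finset (Fin (2 ^ m))) :
    numWeight (2 ^ (m - f.card)) (TS J f Y) = (TS J f Y).ncard := by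
  rw [numWeight, Set.sep_eq_self_iff_mem_true.mpr]
  rintro _ ⟨p, hp, h0, rfl⟩
  rw [hammingNorm_removePos_of_vanish h0, hp.2.2.2, hammingNorm_monEv]

theorem numWeight_TP (J : Finset (Mon m)) (f : Mon m) (X : Finset (Fin (2 ^ m))) :
    numWeight (2 ^ (m - f.card)) (TP J f X) = (vanishT J f X).ncard := by
  rw [numWeight, show {c ∈ TP J f X | hammingNorm c = 2 ^ (m - f.card)} =
    (fun p => removePos X (Poly.ev p)) '' vanishT J f X from ?_]
  · exact ((injOn_removePos_ev X).mono fun p hp => hp.2).ncard_image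
  · ext v
    constructor
    · rintro ⟨⟨p, hp, rfl⟩, hw⟩
      refine ⟨p, ⟨hp, vanish_of_hammingNorm_removePos ?_⟩, rfl⟩
      rw [hw, hp.2.2.2, hammingNorm_monEv]
    · rintro ⟨p, ⟨hp, h0⟩, rfl⟩
      refine ⟨⟨p, hp, rfl⟩, ?_⟩
      rw [hammingNorm_removePos_of_vanish h0, hp.2.2.2, hammingNorm_monEv]

theorem rev_mem_firstPos {i : ℕ} {k : Fin (2 ^ m)} : Fin.rev k ∈ firstPos m i ↔ k ∈ lastPos m i := by
  simp only [firstPos, lastPos, Finset.mem_filter, Finset.mem_univ, true_and, Fin.val_rev]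
  have := k.2
  omega

theorem ncard_vanishT_lastPos {J : Finset (Mon m)} (hJ : Decreasing J) (f : Mon m) (i : ℕ) :
    (vanishT J f (lastPos m i)).ncard = (vanishT J f (firstPos m i)).ncard := by
  have h : vanishT J f (firstPos m i) = Poly.translate '' vanishT J f (lastPos m i) := by
    ext p
    constructor
    · rintro ⟨hp, h0⟩
      refine ⟨Poly.translate p, ⟨Poly.translate_mem_T hJ hp, fun k hk => ?_⟩,
        Poly.translate_translate p⟩
      rw [Poly.ev_translate, h0 _ (rev_mem_firstPos.mpr hk)]
    · rintro ⟨q, ⟨hq, h0⟩, rfl⟩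
      refine ⟨Poly.translate_mem_T hJ hq, fun k hk => ?_⟩
      rw [Poly.ev_translate, h0 _ (rev_mem_firstPos.mp (by rwa [Fin.rev_rev]))]
  rw [h, Set.ncard_image_of_injective _ (Function.LeftInverse.injective Poly.translate_translate)]

theorem ncard_vanishT_eq_P {J : Finset (Mon m)} (hJ : Decreasing J) (f : Mon m) (i : ℕ) :
    (vanishT J f (lastPos m i)).ncard = P J f (2 ^ (m - f.card)) i := by
  rw [P, numWeight_TP, ncard_vanishT_lastPos hJ]

/-- The polynomials that give the words of weight `d` in the shortened code. -/
def shortenedPolys (I : Finset (Mon m)) (Y : Finset (Fin (2 ^ m))) (d : ℕ) : Set (Poly m) :=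
  {p | (∀ g, g ∉ I → p g = 0) ∧ (∀ k ∈ Y, Poly.ev p k = 0) ∧ hammingNorm (Poly.ev p) = d}

theorem numWeight_shortenedCode (I : Finset (Mon m)) (Y : Finset (Fin (2 ^ m))) (d : ℕ) :
    numWeight d (shortenedCode I Y) = (shortenedPolys I Y d).ncard := by
  rw [numWeight, show {c ∈ shortenedCode I Y | hammingNorm c = d} =
    (fun p => removePos Y (Poly.ev p)) '' shortenedPolys I Y d from ?_]
  · exact ((injOn_removePos_ev Y).mono fun p hp => hp.2.1).ncard_image
  · ext v
    constructor
    · rintro ⟨⟨c, hc, h0, rfl⟩, hw⟩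
      obtain ⟨p, hp, rfl⟩ := mem_code_iff.mp hc
      exact ⟨p, ⟨hp, h0, (hammingNorm_removePos_of_vanish h0).symm.trans hw⟩, rfl⟩
    · rintro ⟨p, ⟨hp, h0, hw⟩, rfl⟩
      exact ⟨⟨_, mem_code_iff.mpr ⟨p, hp, rfl⟩, h0, rfl⟩,
        (hammingNorm_removePos_of_vanish h0).trans hw⟩

/-- The coefficient of `g` is determined by the values at the factors of `g`, whose positions are no
earlier than that of `g`. -/
theorem Poly.coeff_eq_zero_of_index_mem_lastPos {i : ℕ} {p : Poly m}
    (h : ∀ k ∈ lastPos m i, Poly.ev p k = 0) {g : Mon m} (hg : Mon.index g ∈ lastPos m i) :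
    p g = 0 := by
  refine Poly.coeff_eq_zero p g fun f hf => ?_
  rw [← Poly.ev_index]
  refine h _ ?_
  have h1 := Fin.le_def.mp (Dom.of_subset hf).index_le
  simp only [lastPos, Finset.mem_filter, Finset.mem_univ, true_and] at hg ⊢
  omega

theorem shortenedPolys_eq {r i : ℕ} {I J : Finset (Mon m)} (hI : HasOrder I r)
    (hS : ShortenedDecreasing I (lastPos m i)) (hJ : Decreasing J) (hJr : HasOrder J r)
    (hIJ : degPart I r ⊆ J) : shortenedPolys I (lastPos m i) (2 ^ (m - r)) =
      ⋃ f ∈ degPart I r, vanishT J f (lastPos m i) := by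
  have hr : r ≤ m := by
    obtain ⟨⟨f, -, rfl⟩, -⟩ := hI
    simpa using Finset.card_le_univ f
  have hpow : 2 ^ (m - r) * 2 ^ r = 2 ^ m := by rw [← pow_add, Nat.sub_add_cancel hr]
  have hsupp {K : Finset (Mon m)} (hK : HasOrder K r) {p : Poly m} (hp : ∀ g, g ∉ K → p g = 0)
      (g : Mon m) (hg : p g ≠ 0) : g.card ≤ r := hK.2 g (by_contra fun h => hg (hp g h))
  ext p
  simp only [Set.mem_iUnion, degPart, Finset.mem_filter, exists_prop]
  constructor
  · rintro ⟨hp, h0, hw⟩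
    obtain ⟨f, hc, hf, hd⟩ := Poly.exists_dom (hsupp hI hp) (by rw [hw, hpow])
    have hfI : f ∈ I := by
      by_contra h
      exact one_ne_zero (hf.symm.trans (hp f h))
    have hfJ : f ∈ J := hIJ (Finset.mem_filter.mpr ⟨hfI, hc⟩)
    refine ⟨f, ⟨hfI, hc⟩, ⟨fun g hg => ?_, hf, fun g hg => ?_, ?_⟩, h0⟩
    · by_contra h
      exact (hd g h).index_le.not_gt hg
    · by_contra h
      exact hg (hJ g f (hd g h).le hfJ)
    · rw [hw, hammingNorm_monEv, hc]
  · rintro ⟨f, ⟨hfI, hc⟩, ⟨h1, h2, h3, h4⟩, h0⟩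
    rw [hammingNorm_monEv, hc] at h4
    -- The dominating monomial has the lowest index in `p`, so it is the prescribed leading monomial
    -- `f`.
    obtain ⟨f', -, hf', hd⟩ := Poly.exists_dom (hsupp hJr h3) (by rw [h4, hpow])
    obtain rfl : f' = f := by
      refine index_injective (le_antisymm ?_ ?_)
      · exact (hd f (by rw [h2]; exact one_ne_zero)).index_le
      · by_contra! h
        exact one_ne_zero (hf'.symm.trans (h1 f' h))
    refine ⟨fun g hg => ?_, h0, h4⟩
    by_contra h
    -- A monomial dominated by `f'` is in `I` or has its index in `Y`; vanishing on `Y` excludes the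
    -- latter.
    rcases Finset.mem_union.mp (hS g f' (hd g h).le (Finset.mem_union_left _ hfI)) with h' | h'
    · exact hg h'
    · exact h (Poly.coeff_eq_zero_of_index_mem_lastPos h0 (Finset.mem_filter.mp h').2)

theorem pairwise_disjoint_vanishT (J : Finset (Mon m)) (X : Finset (Fin (2 ^ m))) :
    Pairwise (Function.onFun Disjoint fun f => vanishT J f X) := by
  have key (f g : Mon m) (h : Mon.index f < Mon.index g) :
      Disjoint (vanishT J f X) (vanishT J g X) :=
    Set.disjoint_left.mpr fun p hp hq => one_ne_zero (hp.1.2.1.symm.trans (hq.1.1 f h))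
  intro f g hne
  rcases lt_or_gt_of_ne (index_injective.ne hne) with h | h
  · exact key f g h
  · exact (key g f h).symm

end PolarShortening

theorem theorem5 (m r i : ℕ) (hi : i ≤ 2 ^ m) :
    -- The number of surviving words of `T(f)`, for `f` of weight `2 ^ (m - r)`.
    (∀ J : Finset (PolarShortening.Mon m), PolarShortening.Decreasing J →
      ∀ f ∈ J, f.card = r →
        (PolarShortening.TS J f (PolarShortening.lastPos m i)).ncard =
            PolarShortening.P J f (2 ^ (m - r)) i ∧
          PolarShortening.numWeight (2 ^ (m - r))
              (PolarShortening.TS J f (PolarShortening.lastPos m i)) =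
            PolarShortening.P J f (2 ^ (m - r)) i) ∧
    -- The number of words of weight `2 ^ (m - r)` in the shortened code; `J` is any decreasing
    -- information set of order `r` in which the sets `T(f)` are formed.
    (∀ I : Finset (PolarShortening.Mon m), PolarShortening.HasOrder I r →
      PolarShortening.ShortenedDecreasing I (PolarShortening.lastPos m i) →
      ∀ J : Finset (PolarShortening.Mon m), PolarShortening.Decreasing J →
        PolarShortening.HasOrder J r → PolarShortening.degPart I r ⊆ J →
        PolarShortening.numWeight (2 ^ (m - r))
            (PolarShortening.shortenedCode I (PolarShortening.lastPos m i)) =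
          ∑ f ∈ PolarShortening.degPart I r, PolarShortening.P J f (2 ^ (m - r)) i) := by
  open PolarShortening in
  refine ⟨fun J hJ f _ hr => ?_, fun I hI hS J hJ hJr hIJ => ?_⟩
  · subst hr
    have h : (TS J f (lastPos m i)).ncard = P J f (2 ^ (m - f.card)) i := by
      rw [ncard_TS, ncard_vanishT_eq_P hJ]
    exact ⟨h, (numWeight_TS J f _).trans h⟩
  · rw [numWeight_shortenedCode, shortenedPolys_eq hI hS hJ hJr hIJ]
    refine ((degPart I r).finite_toSet.ncard_biUnion (fun _ _ => Set.toFinite _)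
      ((pairwise_disjoint_vanishT J _).set_pairwise _)).trans ?_
    rw [finsum_mem_coe_finset]
    refine Finset.sum_congr rfl fun f hf => ?_
    rw [← (Finset.mem_filter.mp hf).2, ncard_vanishT_eq_P hJ]
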